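/- Let $I\subset\mathbb{R}$ be a closed interval and let $f:I\to I$ be piecewise monotone, i.e. there is a finite partition of $I$ into intervals (possibly reduced to single points) such that $f$ is continuous and strictly monotone on each of them. For $L\ge 2$ let $\mathcal{S}_L$ be the set of permutations $\pi=[\pi_0,\dots,\pi_{L-1}]$ of $\{0,1,\dots,L-1\}$, and for $\pi\in\mathcal{S}_L$ let $$P_\pi=\{x\in I : f^{\pi_0}(x)<f^{\pi_1}(x)<\dots<f^{\pi_{L-1}}(x)\}$$ be the set of points realizing the order pattern $\pi$, where $f^n$ denotes the $n$-th iterate of $f$ and $f^0(x)=x$. Then $f$ has a forbidden order pattern: there are $L\ge 2$ and $\pi\in\mathcal{S}_L$ such that $P_\pi=\varnothing$. -/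

import Mathlib

/-- The point `x` defines (realizes) the order pattern `π = [π₀, …, π_{L-1}]` under `T`:
`T^{π₀}(x) < T^{π₁}(x) < ⋯ < T^{π_{L-1}}(x)`. -/
def DefinesOrderPattern {X : Type*} [LinearOrder X] (T : X → X) {L : ℕ}
    (π : Equiv.Perm (Fin L)) (x : X) : Prop :=
  StrictMono fun i : Fin L => T^[(π i : ℕ)] x

/-- The set `P_π` of all points defining the order pattern `π` under `T`. -/
def orderPatternSet {X : Type*} [LinearOrder X] (T : X → X) {L : ℕ}
    (π : Equiv.Perm (Fin L)) : Set X :=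
  {x | DefinesOrderPattern T π x}

/-- A self-map of an interval `I` of the real line is piecewise monotone if there is a finite
partition of `I` into (nonempty, possibly degenerate) intervals such that `f` is continuous and
strictly monotone (increasing or decreasing) on each of them. The pieces are sets of points of
`I`; as `I` is an interval, order-convex in `I` is the same as being an interval of `ℝ`. -/
def PiecewiseMonotone {I : Set ℝ} (f : I → I) : Prop :=
  ∃ P : Set (Set I), P.Finite ∧ Setoid.IsPartition P ∧
    ∀ J ∈ P, J.OrdConnected ∧ ContinuousOn f J ∧ (StrictMonoOn f J ∨ StrictAntiOn f J)

/-! Prescribe that the points at even times increase while their images alternate low, high, low.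
Among the `N + 1` points at times `4 * i`, two share one of the `N` pieces; by convexity that piece
contains three consecutive even-time points, on which `T` goes up and then down, so it is not
monotone there. -/

/-- Every ranking `key` of the times `0, …, L - 1` is refined by an order pattern: a point which
defines it has its orbit ordered at least as prescribed by `key`. -/
theorem exists_perm_iterate_lt_of_key_lt {X : Type*} [LinearOrder X] (T : X → X) {L : ℕ}
    (key : ℕ → ℕ) :
    ∃ π : Equiv.Perm (Fin L), ∀ x, DefinesOrderPattern T π x →
      ∀ a < L, ∀ b < L, key a < key b → T^[a] x < T^[b] x := by
  let g : Fin L → ℕ := fun i => key i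
  refine ⟨Tuple.sort g, fun x hx a ha b hb hab => ?_⟩
  have hlt : (Tuple.sort g).symm ⟨a, ha⟩ < (Tuple.sort g).symm ⟨b, hb⟩ := by
    by_contra! hle
    have h := Tuple.monotone_sort g hle
    simp only [Function.comp_apply, Equiv.apply_symm_apply, g] at h
    omega
  simpa using hx hlt

/-- The ranking of times which puts the even times `2 * i` first, in increasing order, then the
successors `2 * i + 1` with `i` even, and last the successors with `i` odd. A map whose orbit
is ranked in this way zigzags along the points with even times. -/
def zigzagKey (M t : ℕ) : ℕ :=
  if t % 2 = 0 then t / 2 else if t % 4 = 1 then M + t / 2 else 2 * M + t / 2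

/-- If a linear order has a partition into finitely many order-convex sets, on each of which `T`
is strictly monotone or strictly antitone, then `T` has a forbidden order pattern. -/
theorem exists_orderPatternSet_eq_empty {X : Type*} [LinearOrder X] (T : X → X)
    {P : Set (Set X)} (hfin : P.Finite) (hP : Setoid.IsPartition P)
    (hmono : ∀ J ∈ P, J.OrdConnected ∧ (StrictMonoOn T J ∨ StrictAntiOn T J)) :
    ∃ L : ℕ, 2 ≤ L ∧ ∃ π : Equiv.Perm (Fin L), orderPatternSet T π = ∅ := by
  have : Fintype P := hfin.fintype
  set N := Fintype.card P with hN
  -- Times run up to `4 * N + 1`, the successor of the last point `4 * N`. Hence `t / 2 < 2 * N +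
  -- 1`, and the three blocks of ranks do not overlap.
  obtain ⟨π, hπ⟩ :=
    exists_perm_iterate_lt_of_key_lt T (L := 4 * N + 2) (zigzagKey (2 * N + 1))
  refine ⟨4 * N + 2, by omega, π, Set.eq_empty_of_forall_notMem fun x hx => ?_⟩
  have hlt := hπ x hx
  choose piece hpiece using fun y => (hP.2 y).exists
  obtain ⟨i, j, hne, hij⟩ := Fintype.exists_ne_map_eq_of_card_lt
    (fun i : Fin (N + 1) => (⟨piece (T^[4 * i] x), (hpiece _).1⟩ : P)) (by simp [← hN])
  wlog hlt' : i < j generalizing i j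
  · exact this j i hne.symm hij.symm (lt_of_le_of_ne (not_lt.1 hlt') hne.symm)
  have hij' : (i : ℕ) < j := hlt'
  have hj := j.isLt
  obtain ⟨hJP, hiJ⟩ := hpiece (T^[4 * i] x)
  have hjJ := (hpiece (T^[4 * j] x)).2
  rw [← Subtype.mk.inj hij] at hjJ
  obtain ⟨hconn, hm⟩ := hmono _ hJP
  have h₁ : T^[4 * i] x < T^[4 * i + 2] x :=
    hlt _ (by omega) _ (by omega) (by grind [zigzagKey])
  have h₂ : T^[4 * i + 2] x < T^[4 * i + 4] x :=
    hlt _ (by omega) _ (by omega) (by grind [zigzagKey])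
  have h₃ : T^[4 * i + 4] x ≤ T^[4 * j] x := by
    rcases (show (i : ℕ) + 1 ≤ j from hij').eq_or_lt with h | h
    · rw [← h, mul_add, mul_one]
    · exact (hlt _ (by omega) _ (by omega) (by grind [zigzagKey])).le
  have hmid := hconn.out hiJ hjJ ⟨h₁.le, h₂.le.trans h₃⟩
  have hend := hconn.out hiJ hjJ ⟨(h₁.trans h₂).le, h₃⟩
  have hup : T^[4 * i + 1] x < T^[4 * i + 3] x :=
    hlt _ (by omega) _ (by omega) (by grind [zigzagKey])
  have hdown : T^[4 * i + 5] x < T^[4 * i + 3] x :=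
    hlt _ (by omega) _ (by omega) (by grind [zigzagKey])
  simp only [Function.iterate_succ_apply'] at *
  rcases hm with hm | hm
  · exact lt_asymm hdown (hm hmid hend h₂)
  · exact lt_asymm hup (hm hiJ hmid h₁)

theorem proposition1 (I : Set ℝ) (hconn : I.OrdConnected) (hclosed : IsClosed I)
    (f : I → I) (hf : PiecewiseMonotone f) :
    ∃ L : ℕ, 2 ≤ L ∧ ∃ π : Equiv.Perm (Fin L), orderPatternSet f π = ∅ := by
  obtain ⟨P, hfin, hP, hmono⟩ := hf
  exact exists_orderPatternSet_eq_empty f hfin hP fun J hJ => ⟨(hmono J hJ).1, (hmono J hJ).2.2⟩
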